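/- Let $\mathrm{Top}$ be the site of topological spaces with the topology of open coverings. A stack is a pseudofunctor $\mathrm{Top}^{op}\to\mathrm{Groupoids}$ satisfying descent for morphisms and objects; morphisms of stacks are pseudonatural transformations, fibre products of stacks are two-categorical, and a space $X$ is regarded as the stack $T\mapsto C(T,X)$. A morphism of stacks $G\to H$ is called representable if for every space $U$ and every morphism $U\to H$ the fibre product $U\times_H G$ is equivalent to a space. A representable morphism $G\to H$ is surjective (resp. has local sections) if for every space $U$ and every morphism $U\to H$ the induced continuous map $U\times_H G\to U$ is surjective (resp. has local sections), where a continuous map $f:A\to B$ has local sections if every point $b$ in the image of $f$ has a neighbourhood $N\subseteq B$ with a continuous map $s:N\to A$ such that $f\circ s$ is the inclusion $N\to B$. A stack $G$ is called topological if it admits an atlas, i.e. a morphism $A\to G$ from a space $A$ which is representable, surjective and has local sections. Proposition. Let $G$ be a topological stack and let $X$ be a topological space. Then every morphism $f:X\to G$ is representable. -/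

import Mathlib

open CategoryTheory Bicategory Opposite Limits

universe u v w

set_option linter.checkUnivs false

/-- A presheaf of groupoids on the category of topological spaces, in the lax sense: a
pseudofunctor with groupoid values. -/
structure GroupoidPresheaf where
  toPseudofunctor : LocallyDiscrete TopCat.{u}ᵒᵖ ⥤ᵖ Cat.{v, max u v w}
  isGroupoid (T : LocallyDiscrete TopCat.{u}ᵒᵖ) : IsGroupoid (toPseudofunctor.obj T)

namespace GroupoidPresheaf

/-- The groupoid of sections over a space. -/
abbrev sections (F : GroupoidPresheaf.{u, v, w}) (T : LocallyDiscrete TopCat.{u}ᵒᵖ) :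
    Cat.{v, max u v w} := F.toPseudofunctor.obj T

/-- The pullback functor along a continuous map. -/
abbrev pull (F : GroupoidPresheaf.{u, v, w}) {S T : LocallyDiscrete TopCat.{u}ᵒᵖ} (k : S ⟶ T) :
    F.sections S ⥤ F.sections T := (F.toPseudofunctor.map k).toFunctor

/-- A presheaf of groupoids is a stack if it satisfies descent for morphisms and for objects with
respect to open coverings. -/
def IsStack (F : GroupoidPresheaf.{u, v, w}) : Prop :=
  F.toPseudofunctor.IsStack TopCat.grothendieckTopology.{u}

/-- Morphisms of presheaves of groupoids are the pseudonatural transformations. -/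
abbrev Hom (F G : GroupoidPresheaf.{u, v, w}) :=
  Pseudofunctor.StrongTrans F.toPseudofunctor G.toPseudofunctor

namespace Hom

variable {F G H : GroupoidPresheaf.{u, v, w}}

/-- The functor on sections over `T`. -/
abbrev on (f : Hom F G) (T : LocallyDiscrete TopCat.{u}ᵒᵖ) : F.sections T ⥤ G.sections T :=
  (f.app T).toFunctor

/-- The structure isomorphism `f (k^* x) ≅ k^* (f x)`. -/
def nat (f : Hom F G) {S T : LocallyDiscrete TopCat.{u}ᵒᵖ} (k : S ⟶ T) (x : F.sections S) :
    (f.on T).obj ((F.pull k).obj x) ≅ (G.pull k).obj ((f.on S).obj x) :=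
  (Cat.Hom.toNatIso (f.naturality k)).app x

theorem nat_naturality (f : Hom F G) {S T : LocallyDiscrete TopCat.{u}ᵒᵖ} (k : S ⟶ T)
    {x y : F.sections S} (φ : x ⟶ y) :
    (f.on T).map ((F.pull k).map φ) ≫ (f.nat k y).hom =
      (f.nat k x).hom ≫ (G.pull k).map ((f.on S).map φ) :=
  (Cat.Hom.toNatIso (f.naturality k)).hom.naturality φ

theorem nat_inv_naturality (f : Hom F G) {S T : LocallyDiscrete TopCat.{u}ᵒᵖ} (k : S ⟶ T)
    {x y : F.sections S} (φ : x ⟶ y) :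
    (G.pull k).map ((f.on S).map φ) ≫ (f.nat k y).inv =
      (f.nat k x).inv ≫ (f.on T).map ((F.pull k).map φ) :=
  (Cat.Hom.toNatIso (f.naturality k)).inv.naturality φ

theorem nat_id (f : Hom F G) (S : LocallyDiscrete TopCat.{u}ᵒᵖ) (x : F.sections S) :
    (f.nat (𝟙 S) x).hom ≫ (G.toPseudofunctor.mapId S).hom.toNatTrans.app ((f.on S).obj x) =
      (f.on S).map ((F.toPseudofunctor.mapId S).hom.toNatTrans.app x) := by
  have := congrArg (fun t => t.toNatTrans.app x) (f.naturality_id S)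
  simpa [nat, -Pseudofunctor.StrongTrans.naturality_id] using this

theorem nat_comp (f : Hom F G) {S T U : LocallyDiscrete TopCat.{u}ᵒᵖ} (k : S ⟶ T) (l : T ⟶ U)
    (x : F.sections S) :
    (f.nat (k ≫ l) x).hom ≫
        (G.toPseudofunctor.mapComp k l).hom.toNatTrans.app ((f.on S).obj x) =
      (f.on U).map ((F.toPseudofunctor.mapComp k l).hom.toNatTrans.app x) ≫
        (f.nat l ((F.pull k).obj x)).hom ≫ (G.pull l).map (f.nat k x).hom := by
  have := congrArg (fun t => t.toNatTrans.app x) (f.naturality_comp k l)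
  simpa [nat, -Pseudofunctor.StrongTrans.naturality_comp] using this

end Hom

/-! ### Spaces as presheaves of groupoids -/

/-- The type of continuous maps `T → X`, the objects of a category with only identity morphisms. -/
structure Points (X T : TopCat.{u}) : Type (max u v w) where
  map : T ⟶ X

instance (X T : TopCat.{u}) : Category.{v} (Points.{u, v, w} X T) where
  Hom a b := ULift.{v} (PLift (a.map = b.map))
  id _ := ⟨⟨rfl⟩⟩
  comp p q := ⟨⟨p.down.down.trans q.down.down⟩⟩

theorem Points.hom_eq {X T : TopCat.{u}} {a b : Points.{u, v, w} X T} (p q : a ⟶ b) : p = q :=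
  congrArg ULift.up (Subsingleton.elim p.down q.down)

/-- Precomposition of maps to `X` with a continuous map. -/
def Points.precomp (X : TopCat.{u}) {S T : TopCat.{u}} (k : T ⟶ S) :
    Points.{u, v, w} X S ⥤ Points.{u, v, w} X T where
  obj a := ⟨k ≫ a.map⟩
  map p := ⟨⟨congrArg (k ≫ ·) p.down.down⟩⟩

theorem Points.hom₂_eq {X T : TopCat.{u}} {C : Cat.{v, max u v w}}
    {F G : C ⟶ Cat.of (Points.{u, v, w} X T)} (α β : F ⟶ G) : α = β :=
  Cat.Hom₂.ext (NatTrans.ext (funext fun x => Points.hom_eq (a := F.toFunctor.obj x)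
    (b := G.toFunctor.obj x) _ _))

/-- A space `X`, regarded as the presheaf of (discrete) groupoids `T ↦ C(T, X)`. -/
def ofSpace (X : TopCat.{u}) : GroupoidPresheaf.{u, v, w} where
  toPseudofunctor := LocallyDiscrete.mkPseudofunctor
    (fun T => Cat.of (Points.{u, v, w} X T.unop))
    (fun k => (Points.precomp X k.unop).toCatHom)
    (fun _ => Cat.Hom.isoMk (NatIso.ofComponents (fun _ =>
      { hom := ⟨⟨Category.id_comp _⟩⟩, inv := ⟨⟨(Category.id_comp _).symm⟩⟩ })))
    (fun _ _ => Cat.Hom.isoMk (NatIso.ofComponents (fun _ =>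
      { hom := ⟨⟨Category.assoc _ _ _⟩⟩, inv := ⟨⟨(Category.assoc _ _ _).symm⟩⟩ })))
    (fun _ _ _ => Points.hom₂_eq _ _)
    (fun _ => Points.hom₂_eq _ _)
    (fun _ => Points.hom₂_eq _ _)
  isGroupoid _ := { all_isIso := fun p => ⟨⟨⟨p.down.down.symm⟩⟩,
    Points.hom_eq _ _, Points.hom_eq _ _⟩ }

/-- The continuous map underlying a morphism between spaces (the inverse of the Yoneda
embedding). -/
def Hom.toMap {X Y : TopCat.{u}}
    (f : Hom (ofSpace.{u, v, w} X) (ofSpace.{u, v, w} Y)) : X ⟶ Y :=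
  ((f.on ⟨op X⟩).obj (Points.mk (𝟙 X)) : Points.{u, v, w} Y X).map

/-! ### Two-categorical fibre products -/

section FibreProduct

variable {F G H : GroupoidPresheaf.{u, v, w}} (f : Hom F H) (g : Hom G H)

/-- Sections of `F ×_H G` over `T`: triples `(x, y, φ)` with `x ∈ F(T)`, `y ∈ G(T)` and an
isomorphism `φ : f x ≅ g y` in `H(T)`. -/
abbrev FibreSections (T : LocallyDiscrete TopCat.{u}ᵒᵖ) : Type (max u v w) :=
  CategoricalPullback (f.on T) (g.on T)

/-- Pullback of sections of `F ×_H G` along a continuous map. -/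
def fibrePull {S T : LocallyDiscrete TopCat.{u}ᵒᵖ} (k : S ⟶ T) :
    FibreSections f g S ⥤ FibreSections f g T where
  obj z :=
    { fst := (F.pull k).obj z.fst
      snd := (G.pull k).obj z.snd
      iso := f.nat k z.fst ≪≫ (H.pull k).mapIso z.iso ≪≫ (g.nat k z.snd).symm }
  map {z z'} p :=
    { fst := (F.pull k).map p.fst
      snd := (G.pull k).map p.snd
      w := by
        have h₁ := f.nat_naturality k p.fst
        have h₃ := congrArg (H.pull k).map p.w
        simp only [Functor.map_comp] at h₃
        simp only [Iso.trans_hom, Functor.mapIso_hom, Iso.symm_hom, Category.assoc]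
        rw [reassoc_of% h₁, reassoc_of% h₃, g.nat_inv_naturality] }
  map_id z := by ext <;> simp
  map_comp p q := by ext <;> simp

/-- The isomorphism `1^* z ≅ z`. -/
def fibrePullId (S : LocallyDiscrete TopCat.{u}ᵒᵖ) : fibrePull f g (𝟙 S) ≅ 𝟭 _ :=
  NatIso.ofComponents (fun z => CategoricalPullback.mkIso
    ((Cat.Hom.toNatIso (F.toPseudofunctor.mapId S)).app z.fst)
    ((Cat.Hom.toNatIso (G.toPseudofunctor.mapId S)).app z.snd)
    (by
      have h₁ := f.nat_id S z.fst
      have h₂ := g.nat_id S z.snd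
      have h₃ : (H.pull (𝟙 S)).map z.iso.hom ≫
            (H.toPseudofunctor.mapId S).hom.toNatTrans.app ((g.on S).obj z.snd) =
          (H.toPseudofunctor.mapId S).hom.toNatTrans.app ((f.on S).obj z.fst) ≫ z.iso.hom :=
        (H.toPseudofunctor.mapId S).hom.toNatTrans.naturality z.iso.hom
      change (f.on S).map ((F.toPseudofunctor.mapId S).hom.toNatTrans.app z.fst) ≫ z.iso.hom =
        ((f.nat (𝟙 S) z.fst).hom ≫ (H.pull (𝟙 S)).map z.iso.hom ≫ (g.nat (𝟙 S) z.snd).inv) ≫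
          (g.on S).map ((G.toPseudofunctor.mapId S).hom.toNatTrans.app z.snd)
      simp only [Category.assoc]
      rw [← h₁, ← h₂, Iso.inv_hom_id_assoc, h₃, Category.assoc]))
    (fun p => CategoricalPullback.hom_ext
      ((F.toPseudofunctor.mapId S).hom.toNatTrans.naturality p.fst)
      ((G.toPseudofunctor.mapId S).hom.toNatTrans.naturality p.snd))

/-- The isomorphism `(k l)^* z ≅ l^* k^* z`. -/
def fibrePullComp {S T U : LocallyDiscrete TopCat.{u}ᵒᵖ} (k : S ⟶ T) (l : T ⟶ U) :
    fibrePull f g (k ≫ l) ≅ fibrePull f g k ⋙ fibrePull f g l :=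
  NatIso.ofComponents (fun z => CategoricalPullback.mkIso
    ((Cat.Hom.toNatIso (F.toPseudofunctor.mapComp k l)).app z.fst)
    ((Cat.Hom.toNatIso (G.toPseudofunctor.mapComp k l)).app z.snd)
    (by
      have h₁ := f.nat_comp k l z.fst
      have h₂ := g.nat_comp k l z.snd
      have h₃ : (H.pull (k ≫ l)).map z.iso.hom ≫
            (H.toPseudofunctor.mapComp k l).hom.toNatTrans.app ((g.on S).obj z.snd) =
          (H.toPseudofunctor.mapComp k l).hom.toNatTrans.app ((f.on S).obj z.fst) ≫
            (H.pull l).map ((H.pull k).map z.iso.hom) :=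
        (H.toPseudofunctor.mapComp k l).hom.toNatTrans.naturality z.iso.hom
      change (f.on U).map ((F.toPseudofunctor.mapComp k l).hom.toNatTrans.app z.fst) ≫
          (f.nat l ((F.pull k).obj z.fst)).hom ≫
            (H.pull l).map ((f.nat k z.fst).hom ≫ (H.pull k).map z.iso.hom ≫
              (g.nat k z.snd).inv) ≫ (g.nat l ((G.pull k).obj z.snd)).inv =
        ((f.nat (k ≫ l) z.fst).hom ≫ (H.pull (k ≫ l)).map z.iso.hom ≫
            (g.nat (k ≫ l) z.snd).inv) ≫
          (g.on U).map ((G.toPseudofunctor.mapComp k l).hom.toNatTrans.app z.snd)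
      have h₄ : (g.nat (k ≫ l) z.snd).inv ≫
            (g.on U).map ((G.toPseudofunctor.mapComp k l).hom.toNatTrans.app z.snd) =
          (H.toPseudofunctor.mapComp k l).hom.toNatTrans.app ((g.on S).obj z.snd) ≫
            (H.pull l).map (g.nat k z.snd).inv ≫ (g.nat l ((G.pull k).obj z.snd)).inv := by
        rw [Iso.inv_comp_eq, reassoc_of% h₂, ← Functor.map_comp_assoc]
        simp
      simp only [Category.assoc, Functor.map_comp]
      rw [h₄, reassoc_of% h₃, reassoc_of% h₁]))
    (fun p => CategoricalPullback.hom_ext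
      ((F.toPseudofunctor.mapComp k l).hom.toNatTrans.naturality p.fst)
      ((G.toPseudofunctor.mapComp k l).hom.toNatTrans.naturality p.snd))

/-- The natural transformation `k^* z ⟶ l^* z` for a 2-morphism `k ⟶ l` (that is, for `k = l`). -/
def fibrePullMap₂ {S T : LocallyDiscrete TopCat.{u}ᵒᵖ} {k l : S ⟶ T} (η : k ⟶ l) :
    fibrePull f g k ⟶ fibrePull f g l where
  app z :=
    { fst := (F.toPseudofunctor.map₂ η).toNatTrans.app z.fst
      snd := (G.toPseudofunctor.map₂ η).toNatTrans.app z.snd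
      w := by
        obtain rfl := LocallyDiscrete.eq_of_hom η
        obtain rfl : η = 𝟙 k := Subsingleton.elim _ _
        rw [F.toPseudofunctor.map₂_id, G.toPseudofunctor.map₂_id]
        exact CategoricalPullback.Hom.w (𝟙 ((fibrePull f g k).obj z)) }
  naturality _ _ p := CategoricalPullback.hom_ext
    ((F.toPseudofunctor.map₂ η).toNatTrans.naturality p.fst)
    ((G.toPseudofunctor.map₂ η).toNatTrans.naturality p.snd)

/-- The two-categorical fibre product `F ×_H G`. -/
def fibreProduct : GroupoidPresheaf.{u, v, w} where
  toPseudofunctor :=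
    { obj T := Cat.of (FibreSections f g T)
      map k := (fibrePull f g k).toCatHom
      map₂ η := (fibrePullMap₂ f g η).toCatHom₂
      map₂_id k :=
        Cat.Hom₂.ext (NatTrans.ext (funext fun z => CategoricalPullback.hom_ext
          (congrArg (fun t => t.toNatTrans.app z.fst) (F.toPseudofunctor.map₂_id k))
          (congrArg (fun t => t.toNatTrans.app z.snd) (G.toPseudofunctor.map₂_id k))))
      map₂_comp η θ :=
        Cat.Hom₂.ext (NatTrans.ext (funext fun z => CategoricalPullback.hom_ext
          (congrArg (fun t => t.toNatTrans.app z.fst) (F.toPseudofunctor.map₂_comp η θ))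
          (congrArg (fun t => t.toNatTrans.app z.snd) (G.toPseudofunctor.map₂_comp η θ))))
      mapId S := Cat.Hom.isoMk (fibrePullId f g S)
      mapComp k l := Cat.Hom.isoMk (fibrePullComp f g k l)
      map₂_whisker_left k _ _ η :=
        Cat.Hom₂.ext (NatTrans.ext (funext fun z => CategoricalPullback.hom_ext
          (congrArg (fun t => t.toNatTrans.app z.fst) (F.toPseudofunctor.map₂_whisker_left k η))
          (congrArg (fun t => t.toNatTrans.app z.snd) (G.toPseudofunctor.map₂_whisker_left k η))))
      map₂_whisker_right η l :=
        Cat.Hom₂.ext (NatTrans.ext (funext fun z => CategoricalPullback.hom_ext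
          (congrArg (fun t => t.toNatTrans.app z.fst) (F.toPseudofunctor.map₂_whisker_right η l))
          (congrArg (fun t => t.toNatTrans.app z.snd) (G.toPseudofunctor.map₂_whisker_right η l))))
      map₂_associator k l m :=
        Cat.Hom₂.ext (NatTrans.ext (funext fun z => CategoricalPullback.hom_ext
          (congrArg (fun t => t.toNatTrans.app z.fst) (F.toPseudofunctor.map₂_associator k l m))
          (congrArg (fun t => t.toNatTrans.app z.snd) (G.toPseudofunctor.map₂_associator k l m))))
      map₂_left_unitor k :=
        Cat.Hom₂.ext (NatTrans.ext (funext fun z => CategoricalPullback.hom_ext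
          (congrArg (fun t => t.toNatTrans.app z.fst) (F.toPseudofunctor.map₂_left_unitor k))
          (congrArg (fun t => t.toNatTrans.app z.snd) (G.toPseudofunctor.map₂_left_unitor k))))
      map₂_right_unitor k :=
        Cat.Hom₂.ext (NatTrans.ext (funext fun z => CategoricalPullback.hom_ext
          (congrArg (fun t => t.toNatTrans.app z.fst) (F.toPseudofunctor.map₂_right_unitor k))
          (congrArg (fun t => t.toNatTrans.app z.snd) (G.toPseudofunctor.map₂_right_unitor k)))) }
  isGroupoid T :=
    { all_isIso := fun p => (CategoricalPullback.isIso_iff _ _ p).2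
        ⟨(F.isGroupoid T).all_isIso _, (G.isGroupoid T).all_isIso _⟩ }

/-- The first projection `F ×_H G → F`. -/
def fibreProductFst : Hom (fibreProduct f g) F where
  app T := (CategoricalPullback.π₁ (f.on T) (g.on T)).toCatHom
  naturality k := Cat.Hom.isoMk (F := fibrePull f g k ⋙ CategoricalPullback.π₁ _ _)
    (G := CategoricalPullback.π₁ _ _ ⋙ F.pull k) (Iso.refl _)
  naturality_naturality η := Cat.Hom₂.ext (NatTrans.ext (funext fun z => by
    change (F.toPseudofunctor.map₂ η).toNatTrans.app z.fst ≫ 𝟙 _ =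
      𝟙 _ ≫ (F.toPseudofunctor.map₂ η).toNatTrans.app z.fst
    rw [Category.comp_id, Category.id_comp]))
  naturality_id S := Cat.Hom₂.ext (NatTrans.ext (funext fun z => by
    change 𝟙 _ ≫ (F.toPseudofunctor.mapId S).hom.toNatTrans.app z.fst =
      (F.toPseudofunctor.mapId S).hom.toNatTrans.app z.fst ≫ 𝟙 _ ≫ 𝟙 _
    rw [Category.comp_id, Category.comp_id, Category.id_comp]))
  naturality_comp k l := Cat.Hom₂.ext (NatTrans.ext (funext fun z => by
    change 𝟙 _ ≫ (F.toPseudofunctor.mapComp k l).hom.toNatTrans.app z.fst =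
      (F.toPseudofunctor.mapComp k l).hom.toNatTrans.app z.fst ≫
        𝟙 _ ≫ 𝟙 _ ≫ 𝟙 _ ≫ (F.pull l).map (𝟙 _) ≫ 𝟙 _
    rw [Category.id_comp, Category.id_comp, Category.id_comp, Category.id_comp, Category.comp_id,
      CategoryTheory.Functor.map_id]
    exact (Category.comp_id _).symm))

end FibreProduct

/-! ### Representable morphisms, atlases and topological stacks -/

variable {F G H : GroupoidPresheaf.{u, v, w}}

/-- A morphism is an equivalence if it is an equivalence of groupoids on the sections over every
space. -/
def Hom.IsEquivalence (f : Hom F G) : Prop :=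
  ∀ T, (f.on T).IsEquivalence

/-- `F` is equivalent to a topological space. -/
def IsSpace (F : GroupoidPresheaf.{u, v, w}) : Prop :=
  ∃ (P : TopCat.{u}) (e : Hom (ofSpace P) F), e.IsEquivalence

/-- A morphism `G → H` is representable if for every map `U → H` from a space the fibre product
`U ×_H G` is equivalent to a space. -/
def Hom.IsRepresentable (f : Hom G H) : Prop :=
  ∀ (U : TopCat.{u}) (a : Hom (ofSpace U) H), (fibreProduct a f).IsSpace

/-- `f : G → H` has property `P` if for every map `a : U → H` from a space and every identification
`e` of `U ×_H G` with a space, the induced map of spaces `U ×_H G → U` has property `P`. This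
is meaningful for representable `f`. -/
def Hom.BaseChangesSatisfy (f : Hom G H)
    (P : ∀ {A B : TopCat.{u}}, (A ⟶ B) → Prop) : Prop :=
  ∀ (U : TopCat.{u}) (a : Hom (ofSpace U) H) (A : TopCat.{u})
    (e : Hom (ofSpace A) (fibreProduct a f)), e.IsEquivalence →
      P (Hom.toMap (e.vcomp (fibreProductFst a f)))

/-- A continuous map `p : A → B` has local sections if every point of its image has a neighbourhood
over which `p` has a continuous section. -/
def MapHasLocalSections {A B : TopCat.{u}} (p : A ⟶ B) : Prop :=
  ∀ b ∈ Set.range p, ∃ N ∈ nhds b, ∃ s : C(N, A), ∀ x : N, p (s x) = x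

/-- A representable morphism has local sections. -/
def Hom.HasLocalSections (f : Hom G H) : Prop :=
  f.BaseChangesSatisfy fun p => MapHasLocalSections p

/-- A representable morphism is surjective. -/
def Hom.IsSurjective (f : Hom G H) : Prop :=
  f.BaseChangesSatisfy fun p => Function.Surjective p

/-- An atlas of `G` is a map from a space to `G` which is representable, surjective and has local
sections. -/
structure Hom.IsAtlas {A : TopCat.{u}} (a : Hom (ofSpace A) G) : Prop where
  isRepresentable : a.IsRepresentable
  isSurjective : a.IsSurjective
  hasLocalSections : a.HasLocalSections

/-- A topological stack is a stack which admits an atlas. -/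
structure IsTopologicalStack (G : GroupoidPresheaf.{u, v, w}) : Prop where
  isStack : G.IsStack
  exists_atlas : ∃ (A : TopCat.{u}) (a : Hom (ofSpace A) G), a.IsAtlas

end GroupoidPresheaf

/-! Let `p : A → G` be an atlas and `a : U → G` a map from a space. Spaces are discrete groupoids,
so `U ×_G X` has only identity morphisms: it is a presheaf of sets, and being a space means having a
universal section (`exists_universalSection_of_isSpace`, `isSpace_of_universalSection`). Locally on
`U` this is easy. Since `U ×_G A → U` is surjective with local sections, every point of `U` has an
open neighbourhood `V` on which `a` factors through `p` up to isomorphism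
(`Hom.IsAtlas.exists_local_section`). Then `V ×_G X ≅ V ×_A (X ×_G A)`, a pullback of spaces because
`X ×_G A` is a space `Q` by representability of `p` (`exists_universalAmong_liesOver`). To
globalise, descent for morphisms in `G` makes `U ×_G X` a sheaf of sets
(`fibrePresheaf_isOpenCoverSheaf`), and a sheaf over `U` that is representable over each member of
an open cover of `U` is representable (`exists_universal_glued`). -/

namespace TopCat

/-! ### Points as test maps, and sheaves for open covers -/

/-- The map from the one-point space with value `x`. -/
def pointMap {T : TopCat.{u}} (x : T) : TopCat.of PUnit.{u + 1} ⟶ T :=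
  ofHom (ContinuousMap.const _ x)

theorem pointMap_comp {S T : TopCat.{u}} (x : S) (k : S ⟶ T) :
    pointMap x ≫ k = pointMap (k x) := rfl

theorem pointMap_injective {T : TopCat.{u}} {x y : T} (h : pointMap x = pointMap y) : x = y :=
  congrArg (fun k : TopCat.of PUnit.{u + 1} ⟶ T => k PUnit.unit) h

/-- The inclusion of the preimage of an open set. -/
def preimageIncl {T U : TopCat.{u}} (p : T ⟶ U) (V : Set U) : TopCat.of (p ⁻¹' V) ⟶ T :=
  ofHom ⟨Subtype.val, continuous_subtype_val⟩

theorem isOpenEmbedding_preimageIncl {T U : TopCat.{u}} (p : T ⟶ U) {V : Set U} (hV : IsOpen V) :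
    Topology.IsOpenEmbedding (preimageIncl p V) :=
  (hV.preimage p.hom.continuous).isOpenEmbedding_subtypeVal

/-- A presheaf of sets is a sheaf for families of jointly surjective open embeddings. -/
def IsOpenCoverSheaf (Φ : TopCat.{u}ᵒᵖ ⥤ Type w) : Prop :=
  ∀ ⦃ι : Type u⦄ ⦃T : TopCat.{u}⦄ (W : ι → TopCat.{u}) (j : ∀ i, W i ⟶ T),
    (∀ i, Topology.IsOpenEmbedding (j i)) → (∀ x, ∃ i, x ∈ Set.range (j i)) →
      (Presieve.ofArrows W j).IsSheafFor Φ

/-! ### A sheaf over `U` that is representable locally on `U` is representable -/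

section LocalUniversal

variable {Φ : TopCat.{u}ᵒᵖ ⥤ Type w}

/-- An element `q` of `Φ` is universal among the elements satisfying `C`. -/
def IsUniversalAmong (C : ∀ T : TopCat.{u}, Φ.obj (op T) → Prop) {Q : TopCat.{u}}
    (q : Φ.obj (op Q)) : Prop :=
  C Q q ∧ ∀ (T : TopCat.{u}) (z : Φ.obj (op T)), C T z → ∃! h : T ⟶ Q, Φ.map h.op q = z

theorem map_map_op {S T R : TopCat.{u}} (k : S ⟶ T) (l : R ⟶ S) (z : Φ.obj (op T)) :
    Φ.map l.op (Φ.map k.op z) = Φ.map (l ≫ k).op z := by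
  simp

variable {U : TopCat.{u}} (π : ∀ T : TopCat.{u}, Φ.obj (op T) → (T ⟶ U))

/-- The elements of `Φ` lying over a subset of `U`. -/
def LiesOver (V : Set U) (T : TopCat.{u}) (z : Φ.obj (op T)) : Prop :=
  ∀ x, π _ z x ∈ V

variable (hπ : ∀ {S T : TopCat.{u}} (k : S ⟶ T) (z : Φ.obj (op T)), π _ (Φ.map k.op z) = k ≫ π _ z)

include hπ in
theorem liesOver_map {V : Set U} {S T : TopCat.{u}} (k : S ⟶ T) {z : Φ.obj (op T)}
    (hz : LiesOver π V T z) : LiesOver π V S (Φ.map k.op z) := by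
  intro x
  rw [hπ]
  exact hz (k x)

include hπ in
theorem liesOver_preimageIncl (V : Set U) {T : TopCat.{u}} (z : Φ.obj (op T)) :
    LiesOver π V _ (Φ.map (preimageIncl (π _ z) V).op z) := by
  intro x
  rw [hπ]
  exact x.2

variable {V : U → Set U} (hVo : ∀ x, IsOpen (V x)) (hVm : ∀ x, x ∈ V x)
  {Q : U → TopCat.{u}} {q : ∀ x, Φ.obj (op (Q x))}
  (hq : ∀ x, IsUniversalAmong (LiesOver π (V x)) (q x))

include hq hπ in
theorem eq_of_map_pointMap_universal (x : U) {y y' : Q x}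
    (h : Φ.map (pointMap y).op (q x) = Φ.map (pointMap y').op (q x)) : y = y' := by
  obtain ⟨hx, hu⟩ := hq x
  exact pointMap_injective ((hu _ _ (liesOver_map π hπ _ hx)).unique h rfl)

-- Pointwise agreement forces equal maps to `U`, hence a common open cover by preimages of the `V
-- x`. On each piece both elements are classified by maps to `Q x`, which agree on points;
-- separatedness of the sheaf does the rest.
include hVo hVm hq hπ in
theorem eq_of_map_pointMap (hΦ : IsOpenCoverSheaf Φ) {T : TopCat.{u}} {z z' : Φ.obj (op T)}
    (h : ∀ x : T, Φ.map (pointMap x).op z = Φ.map (pointMap x).op z') : z = z' := by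
  have hzz : π _ z = π _ z' := by
    ext x
    have := congrArg (π _) (h x)
    rw [hπ, hπ, pointMap_comp, pointMap_comp] at this
    exact pointMap_injective this
  have hs := Presieve.isSheafFor_arrows_iff _ _ |>.1
    (hΦ (fun x : U => TopCat.of ((π _ z) ⁻¹' V x)) (fun x => preimageIncl (π _ z) (V x))
      (fun x => isOpenEmbedding_preimageIncl _ (hVo x))
      (fun x => ⟨π _ z x, ⟨x, hVm _⟩, rfl⟩))
  refine (hs (fun x => Φ.map (preimageIncl (π _ z) (V x)).op z) ?_).unique (fun _ => rfl) ?_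
  · intro i k S gi gk hg
    rw [map_map_op, map_map_op, hg]
  · intro x
    have h₁ : LiesOver π (V x) _ (Φ.map (preimageIncl (π _ z) (V x)).op z') := by
      intro y
      rw [hπ, ← hzz]
      exact y.2
    obtain ⟨k, hk, -⟩ := (hq x).2 _ _ (liesOver_preimageIncl π hπ (V x) z)
    obtain ⟨k', hk', -⟩ := (hq x).2 _ _ h₁
    have : k = k' := by
      ext y
      apply eq_of_map_pointMap_universal π hπ hq x
      rw [← pointMap_comp, ← pointMap_comp, ← map_map_op, ← map_map_op, hk, hk', map_map_op,
        map_map_op, pointMap_comp]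
      exact h _
    rw [← hk, ← hk', this]

/-- The points of the space glued from the spaces `Q x`. -/
def glueRel (q : ∀ x, Φ.obj (op (Q x))) : Setoid (Σ x, Q x) :=
  Setoid.ker fun y => Φ.map (pointMap y.2).op (q y.1)

/-- The space glued from the spaces `Q x`. -/
def glued (q : ∀ x, Φ.obj (op (Q x))) : TopCat.{u} :=
  TopCat.of (Quotient (glueRel q))

/-- The inclusion of `Q x` into the glued space. -/
def gluedIncl (q : ∀ x, Φ.obj (op (Q x))) (x : U) : Q x ⟶ glued q :=
  ofHom ⟨fun y => Quotient.mk (glueRel q) ⟨x, y⟩, continuous_quotient_mk'.comp continuous_sigmaMk⟩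

theorem gluedIncl_eq_iff {x x' : U} (y : Q x) (y' : Q x') :
    gluedIncl q x y = gluedIncl q x' y' ↔
      Φ.map (pointMap y).op (q x) = Φ.map (pointMap y').op (q x') :=
  Quotient.eq (r := glueRel q)

theorem isOpen_glued_iff {s : Set (glued q)} :
    IsOpen s ↔ ∀ x, IsOpen (gluedIncl q x ⁻¹' s) := by
  exact (isQuotientMap_quotient_mk' (s := glueRel q)).isOpen_preimage.symm.trans isOpen_sigma_iff

theorem exists_gluedIncl (y : glued q) : ∃ x y', gluedIncl q x y' = y := by
  obtain ⟨⟨x, y⟩, rfl⟩ := Quotient.exists_rep (s := glueRel q) y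
  exact ⟨x, y, rfl⟩

-- Over `V x`, the element `q x'` is classified by a map `k` to `Q x`. The trace on `Q x'` of the
-- image of `s` is `k⁻¹(s)`, open in an open subset of `Q x'`.
include hVo hq hπ in
theorem isOpenEmbedding_gluedIncl (x : U) : Topology.IsOpenEmbedding (gluedIncl q x) := by
  refine .of_continuous_injective_isOpenMap (gluedIncl q x).hom.continuous ?_ ?_
  · intro y y' h
    exact eq_of_map_pointMap_universal π hπ hq x ((gluedIncl_eq_iff _ _).1 h)
  · intro s hs
    rw [isOpen_glued_iff]
    intro x'
    obtain ⟨k, hk, -⟩ := (hq x).2 _ _ (liesOver_preimageIncl π hπ (V x) (q x'))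
    have hk' (y) : gluedIncl q x (k y) = gluedIncl q x' (preimageIncl (π _ (q x')) (V x) y) := by
      rw [gluedIncl_eq_iff, ← pointMap_comp, ← pointMap_comp, ← map_map_op, hk, map_map_op]
    convert (isOpenEmbedding_preimageIncl (π _ (q x')) (hVo x)).isOpenMap _
      (hs.preimage k.hom.continuous) using 1
    ext y
    constructor
    · rintro ⟨t, ht, hty⟩
      have hy : π _ (q x') y ∈ V x := by
        have := congrArg (π _) ((gluedIncl_eq_iff _ _).1 hty)
        rw [hπ, hπ, pointMap_comp, pointMap_comp] at this
        rw [← pointMap_injective this]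
        exact (hq x).1 t
      refine ⟨⟨y, hy⟩, ?_, rfl⟩
      have : k ⟨y, hy⟩ = t := by
        apply eq_of_map_pointMap_universal π hπ hq x
        rw [← gluedIncl_eq_iff, hty, hk']
        rfl
      change k ⟨y, hy⟩ ∈ s
      rwa [this]
    · rintro ⟨y, hy, rfl⟩
      exact ⟨k y, hy, hk' y⟩

include hVo hVm hq hπ in
theorem exists_universal_glued (hΦ : IsOpenCoverSheaf Φ) :
    ∃ q₀ : Φ.obj (op (glued q)), ∀ (T : TopCat.{u}) (z : Φ.obj (op T)),
      ∃! h : T ⟶ glued q, Φ.map h.op q₀ = z := by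
  obtain ⟨q₀, hq₀, -⟩ := Presieve.isSheafFor_arrows_iff _ _ |>.1
    (hΦ Q (gluedIncl q) (isOpenEmbedding_gluedIncl π hπ hVo hq)
      (fun y => (exists_gluedIncl y).imp fun _ => id)) q (by
    intro x x' S g g' h
    -- Compatibility on overlaps may be tested on points, where it is the gluing relation itself.
    apply eq_of_map_pointMap π hπ hVo hVm hq hΦ
    intro y
    rw [map_map_op, map_map_op, pointMap_comp, pointMap_comp, ← gluedIncl_eq_iff]
    exact congrArg (fun t : S ⟶ glued q => t y) h)
  have hpt (x) (y : Q x) : Φ.map (pointMap (gluedIncl q x y)).op q₀ =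
      Φ.map (pointMap y).op (q x) := by
    rw [← pointMap_comp, ← map_map_op, hq₀]
  -- A point of the glued space is determined by the element it pulls back from `q₀`. This makes the
  -- local classifying maps agree and gives uniqueness.
  have hinj {y y' : glued q} (h : Φ.map (pointMap y).op q₀ = Φ.map (pointMap y').op q₀) :
      y = y' := by
    obtain ⟨x, y, rfl⟩ := exists_gluedIncl y
    obtain ⟨x', y', rfl⟩ := exists_gluedIncl y'
    rwa [gluedIncl_eq_iff, ← hpt, ← hpt]
  refine ⟨q₀, fun T z => ?_⟩
  choose k hk _ using fun x => (hq x).2 _ _ (liesOver_preimageIncl π hπ (V x) z)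
  have hk' (x y) : Φ.map (pointMap (gluedIncl q x (k x y))).op q₀ =
      Φ.map (pointMap y.1).op z := by
    rw [hpt, ← pointMap_comp, ← map_map_op, hk, map_map_op]
    rfl
  -- At `y` the chart indexed by the image of `y` in `U` is used; by `h₀'` any other chart around
  -- `y` gives the same value, whence continuity.
  let h₀ (y : T) : glued q := gluedIncl q (π _ z y) (k _ ⟨y, hVm _⟩)
  have h₀' (x y) : h₀ y.1 = gluedIncl q x (k x y) := hinj ((hk' _ _).trans (hk' x y).symm)
  have hc : Continuous h₀ := by
    rw [continuous_iff_continuousAt]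
    intro y
    have hc : Continuous (h₀ ∘ preimageIncl (π _ z) (V (π _ z y))) := by
      convert (k (π _ z y) ≫ gluedIncl q _).hom.continuous using 1
      exact funext (h₀' _)
    exact ((isOpenEmbedding_preimageIncl (π _ z) (hVo (π _ z y))).continuousAt_iff
      (x := ⟨y, hVm _⟩)).1 hc.continuousAt
  let h₁ : T ⟶ glued q := ofHom (ContinuousMap.mk h₀ hc)
  refine ⟨h₁, ?_, ?_⟩
  · apply eq_of_map_pointMap π hπ hVo hVm hq hΦ
    intro y
    rw [map_map_op, pointMap_comp]
    exact hk' _ ⟨y, hVm _⟩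
  · intro h hh
    ext y
    apply hinj
    rw [← pointMap_comp, ← map_map_op, hh]
    exact (hk' _ ⟨y, hVm _⟩).symm

end LocalUniversal

end TopCat

namespace GroupoidPresheaf

/-! ### The fibre product of two spaces as a presheaf of sets -/

section SpacesOverPresheaf

variable {G : GroupoidPresheaf.{u, v, w}} {X Y : TopCat.{u}}
  (f : Hom (ofSpace.{u, v, w} X) G) (g : Hom (ofSpace.{u, v, w} Y) G)

instance (X : TopCat.{u}) (T : LocallyDiscrete TopCat.{u}ᵒᵖ)
    (x y : (ofSpace.{u, v, w} X).sections T) : Subsingleton (x ⟶ y) :=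
  ⟨fun p q => Points.hom_eq (X := X) (T := T.as.unop) p q⟩

theorem ofSpace_eq_of_hom {T : LocallyDiscrete TopCat.{u}ᵒᵖ}
    {x y : (ofSpace.{u, v, w} X).sections T} (p : x ⟶ y) : x = y :=
  congrArg (Points.mk (X := X) (T := T.as.unop)) (ULift.down (p : ULift (PLift _))).down

variable {f g} in
theorem FibreSections.hom_eq {T : LocallyDiscrete TopCat.{u}ᵒᵖ} {z z' : FibreSections f g T}
    (p q : z ⟶ z') : p = q :=
  CategoricalPullback.hom_ext (Subsingleton.elim _ _) (Subsingleton.elim _ _)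

-- Both factors are discrete, so the components of a morphism are identities, and its compatibility
-- square then identifies the two isomorphisms in `G`.
variable {f g} in
theorem FibreSections.eq_of_hom {T : LocallyDiscrete TopCat.{u}ᵒᵖ} {z z' : FibreSections f g T}
    (p : z ⟶ z') : z = z' := by
  obtain ⟨x, y, φ⟩ := z
  obtain ⟨x', y', φ'⟩ := z'
  obtain rfl : x = x' := ofSpace_eq_of_hom p.fst
  obtain rfl : y = y' := ofSpace_eq_of_hom p.snd
  have h := p.w
  rw [Subsingleton.elim p.fst (𝟙 x), Subsingleton.elim p.snd (𝟙 y)] at h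
  obtain rfl : φ = φ' := Iso.ext (by simpa using h.symm)
  rfl

/-- The fibre product of two spaces over `G`, as a presheaf of sets. -/
def fibrePresheaf : TopCat.{u}ᵒᵖ ⥤ Type (max u v w) where
  obj T := FibreSections f g ⟨T⟩
  map k := ↾(fibrePull f g k.toLoc).obj
  map_id T := by
    ext z
    exact FibreSections.eq_of_hom ((fibrePullId f g ⟨T⟩).hom.app z)
  map_comp k l := by
    ext z
    exact FibreSections.eq_of_hom ((fibrePullComp f g k.toLoc l.toLoc).hom.app z)

/-- A section `q` is universal if every section is the pullback of `q` along a unique map. -/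
def IsUniversalSection {Q : TopCat.{u}} (q : (fibrePresheaf f g).obj (op Q)) : Prop :=
  ∀ (T : TopCat.{u}) (z : (fibrePresheaf f g).obj (op T)),
    ∃! h : T ⟶ Q, (fibrePresheaf f g).map h.op q = z

variable {f g}

/-- Yoneda: the image of `𝟙 Q` under the equivalence is universal. -/
theorem exists_universalSection_of_isSpace (h : (fibreProduct f g).IsSpace) :
    ∃ (Q : TopCat.{u}) (q : (fibrePresheaf f g).obj (op Q)), IsUniversalSection f g q := by
  obtain ⟨Q, e, he⟩ := h
  have hk {T : TopCat.{u}} (k : T ⟶ Q) :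
      (fibrePresheaf f g).map k.op ((e.on ⟨op Q⟩).obj (Points.mk (𝟙 Q))) =
        (e.on ⟨op T⟩).obj (Points.mk k) := by
    refine FibreSections.eq_of_hom ((e.nat k.op.toLoc (Points.mk (𝟙 Q))).inv ≫
      (e.on ⟨op T⟩).map ?_)
    exact ⟨⟨Category.comp_id k⟩⟩
  refine ⟨Q, (e.on ⟨op Q⟩).obj (Points.mk (𝟙 Q)), fun T z => ?_⟩
  have := he ⟨op T⟩
  refine ⟨((e.on ⟨op T⟩).objPreimage z : Points Q T).map, ?_, fun k' hk' => ?_⟩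
  · exact (hk _).trans (FibreSections.eq_of_hom ((e.on ⟨op T⟩).objObjPreimageIso z).hom)
  · have hz : (e.on ⟨op T⟩).obj (Points.mk k') = z := (hk k').symm.trans hk'
    have p : Points.mk k' ⟶ ((e.on ⟨op T⟩).objPreimage z : Points Q T) :=
      (e.on ⟨op T⟩).preimage (eqToHom hz ≫ ((e.on ⟨op T⟩).objObjPreimageIso z).inv)
    exact p.down.down

/-- The equivalence is `k ↦ k^* q`: existence of classifying maps gives essential surjectivity,
uniqueness gives fullness. All coherences hold because hom-sets are subsingletons. -/
theorem isSpace_of_universalSection {Q : TopCat.{u}} {q : (fibrePresheaf f g).obj (op Q)}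
    (hq : IsUniversalSection f g q) : (fibreProduct f g).IsSpace := by
  let E (T : LocallyDiscrete TopCat.{u}ᵒᵖ) :
      Points.{u, v, w} Q T.as.unop ⥤ FibreSections f g T :=
    { obj k := (fibrePresheaf f g).map k.map.op q
      map p := eqToHom (by rw [p.down.down])
      map_id _ := FibreSections.hom_eq _ _
      map_comp _ _ := FibreSections.hom_eq _ _ }
  let e : Hom (ofSpace.{u, v, w} Q) (fibreProduct f g) :=
    { app T := (E T).toCatHom
      naturality {S T} k := Cat.Hom.isoMk
        (NatIso.ofComponents (F := Points.precomp Q k.as.unop ⋙ E T) (G := E S ⋙ fibrePull f g k)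
          (fun x => eqToIso ((fibrePresheaf f g).map_comp_apply x.map.op k.as q))
          (fun _ => FibreSections.hom_eq _ _))
      naturality_naturality _ :=
        Cat.Hom₂.ext (NatTrans.ext (funext fun _ => FibreSections.hom_eq _ _))
      naturality_id _ :=
        Cat.Hom₂.ext (NatTrans.ext (funext fun _ => FibreSections.hom_eq _ _))
      naturality_comp _ _ :=
        Cat.Hom₂.ext (NatTrans.ext (funext fun _ => FibreSections.hom_eq _ _)) }
  refine ⟨Q, e, fun T => ?_⟩
  change (E T).IsEquivalence
  exact
    { faithful := ⟨fun _ => Points.hom_eq _ _⟩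
      full := ⟨fun {x y} p => ⟨⟨⟨(hq _ _).unique (FibreSections.eq_of_hom p) rfl⟩⟩,
        FibreSections.hom_eq _ _⟩⟩
      essSurj := ⟨fun z => by
        obtain ⟨k, hk, -⟩ := hq T.as.unop z
        exact ⟨⟨k⟩, ⟨eqToIso hk⟩⟩⟩ }

end SpacesOverPresheaf

end GroupoidPresheaf

/-! ### Gluing continuous maps along open embeddings -/

namespace TopCat

theorem ofArrows_mem_precoverage {ι : Type w} {T : TopCat.{u}} {W : ι → TopCat.{u}}
    {j : ∀ i, W i ⟶ T} (hj : ∀ i, Topology.IsOpenEmbedding (j i))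
    (hj' : ∀ x, ∃ i, x ∈ Set.range (j i)) :
    Presieve.ofArrows W j ∈ precoverage T := by
  refine ⟨?_, ?_⟩
  · simpa using hj'
  · simpa using hj

theorem exists_unique_glue {ι : Type w} {T X : TopCat.{u}} {W : ι → TopCat.{u}}
    {j : ∀ i, W i ⟶ T} (hj : ∀ i, Topology.IsOpenEmbedding (j i))
    (hj' : ∀ x, ∃ i, x ∈ Set.range (j i)) (s : ∀ i, W i ⟶ X)
    (hs : ∀ i i' (Y : TopCat.{u}) (k : Y ⟶ W i) (k' : Y ⟶ W i'), k ≫ j i = k' ≫ j i' →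
      k ≫ s i = k' ≫ s i') : ∃! t : T ⟶ X, ∀ i, j i ≫ t = s i := by
  have h : Presieve.IsSheaf grothendieckTopology (yoneda.obj X) :=
    GrothendieckTopology.Subcanonical.isSheaf_of_isRepresentable _
  have h' := (Presieve.isSheafFor_iff_generate _).2
    (h _ (Precoverage.generate_mem_toGrothendieck (ofArrows_mem_precoverage hj hj')))
  exact (Presieve.isSheafFor_arrows_iff _ _).1 h' s hs

end TopCat

namespace GroupoidPresheaf

/-! ### Descent for morphisms in `G` makes the fibre product a sheaf -/

section SheafOfFibreSections

variable {G : GroupoidPresheaf.{u, v, w}} {X Y : TopCat.{u}}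

theorem isIso_of_section {T : LocallyDiscrete TopCat.{u}ᵒᵖ} {x y : G.sections T} (φ : x ⟶ y) :
    IsIso φ :=
  (G.isGroupoid T).all_isIso φ

/-- The formal core of descent compatibility: two morphisms that restrict to the same `θ` on an
overlap commute with the gluing isomorphisms. -/
theorem comp_inv_comp_eq {C : Type*} [Category* C] {M N M₁ N₁ M₂ N₂ : C} (α₁ : M ≅ M₁) (α₂ : M ≅ M₂)
    (β₁ : N ≅ N₁) (β₂ : N ≅ N₂) {θ : M ⟶ N} {ψ₁ : M₁ ⟶ N₁} {ψ₂ : M₂ ⟶ N₂}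
    (h₁ : α₁.hom ≫ ψ₁ = θ ≫ β₁.hom) (h₂ : α₂.hom ≫ ψ₂ = θ ≫ β₂.hom) :
    ψ₁ ≫ β₁.inv ≫ β₂.hom = (α₁.inv ≫ α₂.hom) ≫ ψ₂ := by
  rw [Category.assoc, h₂, ← cancel_epi α₁.hom, reassoc_of% h₁]
  simp

namespace Hom

/-- The comparison `f r ⟶ k^* (f s)` when `r` is the pullback of `s` along `k`. -/
def transport (f : Hom (ofSpace.{u, v, w} X) G) {S T : LocallyDiscrete TopCat.{u}ᵒᵖ} (k : S ⟶ T)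
    {s : (ofSpace.{u, v, w} X).sections S} {r : (ofSpace.{u, v, w} X).sections T}
    (p : r ⟶ ((ofSpace.{u, v, w} X).pull k).obj s) :
    (f.on T).obj r ⟶ (G.pull k).obj ((f.on S).obj s) :=
  (f.on T).map p ≫ (f.nat k s).hom

instance (f : Hom (ofSpace.{u, v, w} X) G) {S T : LocallyDiscrete TopCat.{u}ᵒᵖ} (k : S ⟶ T)
    {s : (ofSpace.{u, v, w} X).sections S} {r : (ofSpace.{u, v, w} X).sections T}
    (p : r ⟶ ((ofSpace.{u, v, w} X).pull k).obj s) : IsIso (f.transport k p) :=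
  isIso_of_section _

/-- The coherence of `f` for composites. The comparisons `p`, `p'`, `p''` may be arbitrary, since a
space has at most one morphism between two sections. -/
theorem transport_comp_mapComp' (f : Hom (ofSpace.{u, v, w} X) G)
    {S T R : LocallyDiscrete TopCat.{u}ᵒᵖ} (k : S ⟶ T) (l : T ⟶ R) (m : S ⟶ R) (h : k ≫ l = m)
    {s : (ofSpace.{u, v, w} X).sections S} {r : (ofSpace.{u, v, w} X).sections T}
    {t : (ofSpace.{u, v, w} X).sections R}
    (p : r ⟶ ((ofSpace.{u, v, w} X).pull k).obj s)
    (p' : t ⟶ ((ofSpace.{u, v, w} X).pull l).obj r)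
    (p'' : t ⟶ ((ofSpace.{u, v, w} X).pull m).obj s) :
    f.transport m p'' ≫
        (G.toPseudofunctor.mapComp' k l m h).hom.toNatTrans.app ((f.on S).obj s) =
      f.transport l p' ≫ (G.pull l).map (f.transport k p) := by
  subst h
  rw [Pseudofunctor.mapComp'_eq_mapComp]
  simp only [transport, Category.assoc, Functor.map_comp]
  rw [nat_comp, ← reassoc_of% (f.nat_naturality l p), ← Functor.map_comp_assoc,
    ← Functor.map_comp_assoc]
  congr 2

end Hom

variable {f : Hom (ofSpace.{u, v, w} X) G} {g : Hom (ofSpace.{u, v, w} Y) G}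

/-- Together with its converse below, this trades an equality of sections for a commutative square
in `G`, to which descent applies. -/
theorem iso_comp_transport {S T : LocallyDiscrete TopCat.{u}ᵒᵖ} (k : S ⟶ T)
    {z : FibreSections f g S} {z' : FibreSections f g T} (h : (fibrePull f g k).obj z = z')
    (p : z'.fst ⟶ ((ofSpace.{u, v, w} X).pull k).obj z.fst)
    (p' : z'.snd ⟶ ((ofSpace.{u, v, w} Y).pull k).obj z.snd) :
    z'.iso.hom ≫ g.transport k p' = f.transport k p ≫ (G.pull k).map z.iso.hom := by
  subst h
  obtain rfl : p = 𝟙 _ := Subsingleton.elim _ _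
  obtain rfl : p' = 𝟙 _ := Subsingleton.elim _ _
  simp [Hom.transport, fibrePull]

theorem fibrePull_eq_of_iso_comp_transport {S T : LocallyDiscrete TopCat.{u}ᵒᵖ} (k : S ⟶ T)
    {z : FibreSections f g S} {z' : FibreSections f g T}
    (p : z'.fst ⟶ ((ofSpace.{u, v, w} X).pull k).obj z.fst)
    (p' : z'.snd ⟶ ((ofSpace.{u, v, w} Y).pull k).obj z.snd)
    (h : z'.iso.hom ≫ g.transport k p' = f.transport k p ≫ (G.pull k).map z.iso.hom) :
    (fibrePull f g k).obj z = z' := by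
  refine (FibreSections.eq_of_hom (?_ : z' ⟶ (fibrePull f g k).obj z)).symm
  refine { fst := p, snd := p', w := ?_ }
  change (f.on T).map p ≫ (f.nat k z.fst).hom ≫ (G.pull k).map z.iso.hom ≫ (g.nat k z.snd).inv = _
  rw [Hom.transport, Hom.transport, Category.assoc] at h
  rw [← reassoc_of% h, Iso.hom_inv_id, Category.comp_id]
  rfl

/-- The morphism `k^* (f s) ⟶ k^* (g t)` given by a section over the source of `k`. -/
noncomputable def localHom {S T : LocallyDiscrete TopCat.{u}ᵒᵖ} (k : S ⟶ T)
    {s : (ofSpace.{u, v, w} X).sections S} {t : (ofSpace.{u, v, w} Y).sections S}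
    (z : FibreSections f g T)
    (p : z.fst ⟶ ((ofSpace.{u, v, w} X).pull k).obj s)
    (p' : z.snd ⟶ ((ofSpace.{u, v, w} Y).pull k).obj t) :
    (G.pull k).obj ((f.on S).obj s) ⟶ (G.pull k).obj ((g.on S).obj t) :=
  inv (f.transport k p) ≫ z.iso.hom ≫ g.transport k p'

theorem transport_comp_localHom {S T : LocallyDiscrete TopCat.{u}ᵒᵖ} (k : S ⟶ T)
    {s : (ofSpace.{u, v, w} X).sections S} {t : (ofSpace.{u, v, w} Y).sections S}
    (z : FibreSections f g T)
    (p : z.fst ⟶ ((ofSpace.{u, v, w} X).pull k).obj s)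
    (p' : z.snd ⟶ ((ofSpace.{u, v, w} Y).pull k).obj t) :
    f.transport k p ≫ localHom k z p p' = z.iso.hom ≫ g.transport k p' :=
  IsIso.hom_inv_id_assoc _ _

/-- Up to `mapComp'`, restricting a local morphism yields the local morphism of the restricted
section; hence compatible sections give a morphism of descent data. -/
theorem pull_map_localHom {S T R : LocallyDiscrete TopCat.{u}ᵒᵖ} (k : S ⟶ T) (l : T ⟶ R)
    (m : S ⟶ R) (h : k ≫ l = m)
    {s : (ofSpace.{u, v, w} X).sections S} {t : (ofSpace.{u, v, w} Y).sections S}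
    {z : FibreSections f g T} {z' : FibreSections f g R} (hz : (fibrePull f g l).obj z = z')
    (p : z.fst ⟶ ((ofSpace.{u, v, w} X).pull k).obj s)
    (p' : z.snd ⟶ ((ofSpace.{u, v, w} Y).pull k).obj t)
    (r : z'.fst ⟶ ((ofSpace.{u, v, w} X).pull m).obj s)
    (r' : z'.snd ⟶ ((ofSpace.{u, v, w} Y).pull m).obj t) :
    (G.toPseudofunctor.mapComp' k l m h).hom.toNatTrans.app _ ≫
        (G.pull l).map (localHom k z p p') =
      localHom m z' r r' ≫ (G.toPseudofunctor.mapComp' k l m h).hom.toNatTrans.app _ := by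
  have q : z'.fst ⟶ ((ofSpace.{u, v, w} X).pull l).obj z.fst := eqToHom (by rw [← hz]; rfl)
  have q' : z'.snd ⟶ ((ofSpace.{u, v, w} Y).pull l).obj z.snd := eqToHom (by rw [← hz]; rfl)
  rw [← cancel_epi (f.transport m r),
    reassoc_of% f.transport_comp_mapComp' k l m h p q r, localHom, localHom, Category.assoc,
    Category.assoc, IsIso.hom_inv_id_assoc, g.transport_comp_mapComp' k l m h p' q' r',
    ← Functor.map_comp, IsIso.hom_inv_id_assoc, Functor.map_comp,
    reassoc_of% iso_comp_transport l hz q q']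

/-- The components in `X` and `Y` glue as continuous maps `s`, `t`. The isomorphisms then become
local morphisms between the global objects `f s` and `g t`, so descent for morphisms glues them. -/
theorem fibrePresheaf_isOpenCoverSheaf (hG : G.IsStack) :
    TopCat.IsOpenCoverSheaf (fibrePresheaf f g) := by
  intro ι T W j hj hj'
  have : G.toPseudofunctor.IsStack TopCat.grothendieckTopology.{u} := hG
  obtain ⟨hff⟩ := (G.toPseudofunctor.isPrestackFor_ofArrows_iff j).1
    (G.toPseudofunctor.isPrestackFor (J := TopCat.grothendieckTopology.{u}) _
      (Precoverage.generate_mem_toGrothendieck (TopCat.ofArrows_mem_precoverage hj hj')))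
  rw [Presieve.isSheafFor_arrows_iff]
  intro z hz
  obtain ⟨s, hs, hs'⟩ := TopCat.exists_unique_glue hj hj'
    (fun i => ((z i).fst : Points X (W i)).map) (fun i i' R k k' h =>
      congrArg (fun y : FibreSections f g ⟨op R⟩ => (y.fst : Points X R).map) (hz i i' R k k' h))
  obtain ⟨t, ht, ht'⟩ := TopCat.exists_unique_glue hj hj'
    (fun i => ((z i).snd : Points Y (W i)).map) (fun i i' R k k' h =>
      congrArg (fun y : FibreSections f g ⟨op R⟩ => (y.snd : Points Y R).map) (hz i i' R k k' h))
  let s₀ : (ofSpace.{u, v, w} X).sections ⟨op T⟩ := Points.mk s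
  let t₀ : (ofSpace.{u, v, w} Y).sections ⟨op T⟩ := Points.mk t
  have p (i) : (z i).fst ⟶ ((ofSpace.{u, v, w} X).pull (j i).op.toLoc).obj s₀ :=
    ⟨⟨(hs i).symm⟩⟩
  have p' (i) : (z i).snd ⟶ ((ofSpace.{u, v, w} Y).pull (j i).op.toLoc).obj t₀ :=
    ⟨⟨(ht i).symm⟩⟩
  let ψ : (G.toPseudofunctor.toDescentData j).obj ((f.on _).obj s₀) ⟶
      (G.toPseudofunctor.toDescentData j).obj ((g.on _).obj t₀) :=
    { hom i := localHom (j i).op.toLoc (z i) (p i) (p' i)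
      comm := by
        intro R q i₁ i₂ f₁ f₂ h₁ h₂
        have hz' : (fibrePull f g f₂.op.toLoc).obj (z i₂) =
          (fibrePull f g f₁.op.toLoc).obj (z i₁) := (hz i₁ i₂ R f₁ f₂ (h₁.trans h₂.symm)).symm
        have r : ((fibrePull f g f₁.op.toLoc).obj (z i₁)).fst ⟶
            ((ofSpace.{u, v, w} X).pull q.op.toLoc).obj s₀ :=
          ⟨⟨by change f₁ ≫ Points.map (z i₁).fst = q ≫ s
               rw [← hs i₁, ← h₁, Category.assoc]⟩⟩
        have r' : ((fibrePull f g f₁.op.toLoc).obj (z i₁)).snd ⟶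
            ((ofSpace.{u, v, w} Y).pull q.op.toLoc).obj t₀ :=
          ⟨⟨by change f₁ ≫ Points.map (z i₁).snd = q ≫ t
               rw [← ht i₁, ← h₁, Category.assoc]⟩⟩
        have c₁ : (j i₁).op.toLoc ≫ f₁.op.toLoc = q.op.toLoc := by rw [← h₁]; rfl
        have c₂ : (j i₂).op.toLoc ≫ f₂.op.toLoc = q.op.toLoc := by rw [← h₂]; rfl
        -- The sections `z i₁` and `z i₂` have the same restriction to `R`, so both local morphisms
        -- restrict to one and the same `θ`.
        have e₁ := pull_map_localHom (j i₁).op.toLoc f₁.op.toLoc q.op.toLoc c₁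
          rfl (p i₁) (p' i₁) r r'
        have e₂ := pull_map_localHom (j i₂).op.toLoc f₂.op.toLoc q.op.toLoc c₂
          hz' (p i₂) (p' i₂) r r'
        exact comp_inv_comp_eq ((Cat.Hom.toNatIso (G.toPseudofunctor.mapComp' _ _ _ c₁)).app _)
          ((Cat.Hom.toNatIso (G.toPseudofunctor.mapComp' _ _ _ c₂)).app _)
          ((Cat.Hom.toNatIso (G.toPseudofunctor.mapComp' _ _ _ c₁)).app _)
          ((Cat.Hom.toNatIso (G.toPseudofunctor.mapComp' _ _ _ c₂)).app _) e₁ e₂ }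
  -- Fullness of the functor to descent data gives existence; its faithfulness gives uniqueness
  -- below.
  obtain ⟨φ, hφ⟩ := hff.map_surjective ψ
  have hφ' (i) : (G.pull (j i).op.toLoc).map φ = localHom (j i).op.toLoc (z i) (p i) (p' i) :=
    congrArg (fun a => a.hom i) hφ
  have := isIso_of_section φ
  refine ⟨⟨s₀, t₀, asIso φ⟩, fun i => ?_, ?_⟩
  · refine fibrePull_eq_of_iso_comp_transport (j i).op.toLoc (p i) (p' i) ?_
    change _ = _ ≫ (G.pull (j i).op.toLoc).map φ
    rw [hφ']
    exact (transport_comp_localHom _ _ _ _).symm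
  · rintro ⟨s₁, t₁, φ₁⟩ h
    obtain rfl : s₁ = s₀ := congrArg (Points.mk (X := X) (T := T)) (hs' (Points.map s₁) fun i =>
      congrArg (fun y : FibreSections f g ⟨op (W i)⟩ => (y.fst : Points X (W i)).map) (h i))
    obtain rfl : t₁ = t₀ := congrArg (Points.mk (X := Y) (T := T)) (ht' (Points.map t₁) fun i =>
      congrArg (fun y : FibreSections f g ⟨op (W i)⟩ => (y.snd : Points Y (W i)).map) (h i))
    have : φ₁.hom = φ := by
      refine hff.map_injective (Pseudofunctor.DescentData.hom_ext fun i => ?_)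
      change (G.pull (j i).op.toLoc).map φ₁.hom = (G.pull (j i).op.toLoc).map φ
      have := iso_comp_transport (j i).op.toLoc (h i) (p i) (p' i)
      rw [hφ', ← cancel_epi (f.transport (j i).op.toLoc (p i))]
      exact this.symm.trans (transport_comp_localHom _ _ _ _).symm
    congr 1
    exact Iso.ext this

end SheafOfFibreSections

end GroupoidPresheaf

namespace GroupoidPresheaf

/-! ### Local representability from an atlas -/

section LocalRepresentability

variable {G : GroupoidPresheaf.{u, v, w}} {U X A : TopCat.{u}}
  {a : Hom (ofSpace.{u, v, w} U) G} {f : Hom (ofSpace.{u, v, w} X) G}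
  {p : Hom (ofSpace.{u, v, w} A) G}

/-- Sections `a r ≅ p t`, `f s ≅ p t` and `a r ≅ f s` such that the third is the composite of the
first and the inverse of the second. -/
inductive IsComposite {T : LocallyDiscrete TopCat.{u}ᵒᵖ} :
    FibreSections a p T → FibreSections f p T → FibreSections a f T → Prop
  | mk (r : (ofSpace.{u, v, w} U).sections T) (s : (ofSpace.{u, v, w} X).sections T)
      (t : (ofSpace.{u, v, w} A).sections T) (φ : (a.on T).obj r ≅ (p.on T).obj t)
      (η : (f.on T).obj s ≅ (p.on T).obj t) :
      IsComposite ⟨r, t, φ⟩ ⟨s, t, η⟩ ⟨r, s, φ ≪≫ η.symm⟩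

namespace IsComposite

variable {T : LocallyDiscrete TopCat.{u}ᵒᵖ} {z : FibreSections a p T} {y y' : FibreSections f p T}
  {x x' : FibreSections a f T}

theorem fst_eq (h : IsComposite z y x) : z.fst = x.fst := by
  cases h; rfl

theorem snd_eq (h : IsComposite z y x) : z.snd = y.snd := by
  cases h; rfl

/-- In a triangle of isomorphisms, `z` and either of `y`, `x` determine the other. With stability
under pullback, this is the identification of `V ×_G X` with `V ×_A (X ×_G A)`. -/
theorem exists_of_snd_eq (h : z.snd = y.snd) : ∃ x, IsComposite z y x := by
  obtain ⟨r, t, φ⟩ := z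
  obtain ⟨s, t', η⟩ := y
  obtain rfl : t = t' := h
  exact ⟨_, ⟨r, s, t, φ, η⟩⟩

theorem exists_of_fst_eq (h : z.fst = x.fst) : ∃ y, IsComposite z y x := by
  obtain ⟨r, t, φ⟩ := z
  obtain ⟨r', s, η⟩ := x
  obtain rfl : r = r' := h
  refine ⟨⟨s, t, η.symm ≪≫ φ⟩, ?_⟩
  convert! IsComposite.mk r s t φ (η.symm ≪≫ φ)
  ext
  simp

theorem right_unique (h : IsComposite z y x) (h' : IsComposite z y x') : x = x' := by
  cases h
  cases h'
  rfl

theorem middle_unique (h : IsComposite z y x) (h' : IsComposite z y' x) : y = y' := by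
  obtain ⟨r, s, t, φ, η⟩ := h
  generalize hx : (⟨r, s, φ ≪≫ η.symm⟩ : FibreSections a f T) = x at h'
  obtain ⟨_, s', _, _, η'⟩ := h'
  obtain ⟨-, rfl, h⟩ := (CategoricalPullback.mk.injEq ..).mp hx
  have h := congrArg Iso.hom (eq_of_heq h)
  simp only [Iso.trans_hom, Iso.symm_hom, cancel_epi] at h
  obtain rfl : η = η' := Iso.ext_inv h
  rfl

theorem pull (h : IsComposite z y x) {S : LocallyDiscrete TopCat.{u}ᵒᵖ} (k : T ⟶ S) :
    IsComposite ((fibrePull a p k).obj z) ((fibrePull f p k).obj y)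
      ((fibrePull a f k).obj x) := by
  obtain ⟨r, s, t, φ, η⟩ := h
  have e : (fibrePull a f k).obj ⟨r, s, φ ≪≫ η.symm⟩ =
      ⟨_, _, ((fibrePull a p k).obj ⟨r, t, φ⟩).iso ≪≫
        ((fibrePull f p k).obj ⟨s, t, η⟩).iso.symm⟩ :=
    congrArg (CategoricalPullback.mk _ _) (Iso.ext (by simp [fibrePull]))
  rw [e]
  exact ⟨_, _, _, _, _⟩

end IsComposite

/-- The map to `U` underlying a section of `U ×_G X`. -/
def fibreFst (a : Hom (ofSpace.{u, v, w} U) G) (f : Hom (ofSpace.{u, v, w} X) G) (T : TopCat.{u})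
    (z : (fibrePresheaf a f).obj (op T)) : T ⟶ U :=
  Points.map (CategoricalPullback.fst z)

/-- The map to `X` underlying a section of `U ×_G X`. -/
def fibreSnd (a : Hom (ofSpace.{u, v, w} U) G) (f : Hom (ofSpace.{u, v, w} X) G) (T : TopCat.{u})
    (z : (fibrePresheaf a f).obj (op T)) : T ⟶ X :=
  Points.map (CategoricalPullback.snd z)

theorem fibreFst_map {S T : TopCat.{u}} (k : S ⟶ T) (z : (fibrePresheaf a f).obj (op T)) :
    fibreFst a f S ((fibrePresheaf a f).map k.op z) = k ≫ fibreFst a f T z := rfl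

theorem IsComposite.map {T S : TopCat.{u}} {z : (fibrePresheaf a p).obj (op T)}
    {y : (fibrePresheaf f p).obj (op T)} {x : (fibrePresheaf a f).obj (op T)}
    (h : IsComposite (a := a) (f := f) (p := p) z y x) (k : S ⟶ T) :
    IsComposite (a := a) (f := f) (p := p) ((fibrePresheaf a p).map k.op z)
      ((fibrePresheaf f p).map k.op y) ((fibrePresheaf a f).map k.op x) :=
  h.pull k.op.toLoc

/-- The section `w` is a lift `σ` of `a` to `A` over `W ≅ V`. The representing space is the
topological pullback of `σ` and `ρ : Q → A`, with universal element the composite of `w` and `q`. -/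
theorem exists_universalAmong_liesOver {V : Set U} {W : TopCat.{u}}
    (w : (fibrePresheaf a p).obj (op W)) (hw : Topology.IsEmbedding (fibreFst a p W w))
    (hwV : Set.range (fibreFst a p W w) = V)
    {Q : TopCat.{u}} {q : (fibrePresheaf f p).obj (op Q)} (hq : IsUniversalSection f p q) :
    ∃ (P : TopCat.{u}) (x : (fibrePresheaf a f).obj (op P)),
      TopCat.IsUniversalAmong (TopCat.LiesOver (fibreFst a f) V) x := by
  let σ := fibreSnd a p W w
  let ρ := fibreSnd f p Q q
  obtain ⟨x, hx⟩ := IsComposite.exists_of_snd_eq (a := a) (f := f) (p := p)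
    (z := (fibrePresheaf a p).map (pullback.fst σ ρ).op w)
    (y := (fibrePresheaf f p).map (pullback.snd σ ρ).op q)
    (congrArg (Points.mk (X := A) (T := pullback σ ρ)) pullback.condition)
  have hx' {T : TopCat.{u}} (k : T ⟶ pullback σ ρ) :
      IsComposite (a := a) (f := f) (p := p)
        ((fibrePresheaf a p).map (k ≫ pullback.fst σ ρ).op w)
        ((fibrePresheaf f p).map (k ≫ pullback.snd σ ρ).op q)
        ((fibrePresheaf a f).map k.op x) := by
    rw [← TopCat.map_map_op, ← TopCat.map_map_op]
    exact hx.map k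
  have hxf : pullback.fst σ ρ ≫ fibreFst a p W w = fibreFst a f _ x :=
    congrArg (Points.map (X := U) (T := pullback σ ρ)) hx.fst_eq
  refine ⟨pullback σ ρ, x, ?_, fun T x' hx'V => ?_⟩
  · intro y
    rw [← hxf, ← hwV]
    exact ⟨pullback.fst σ ρ y, rfl⟩
  · have hr (t : T) : fibreFst a f T x' t ∈ Set.range (fibreFst a p W w) := hwV ▸ hx'V t
    -- A map into `U` with values in `V` lifts uniquely, and continuously, through the embedding of
    -- `W`.
    choose l₀ hl₀ using hr
    have hl₀c : Continuous l₀ := by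
      rw [hw.continuous_iff]
      convert (fibreFst a f T x').hom.continuous using 1
      exact funext hl₀
    let l : T ⟶ W := TopCat.ofHom ⟨l₀, hl₀c⟩
    have hl : l ≫ fibreFst a p W w = fibreFst a f T x' := by
      ext t
      exact hl₀ t
    -- Composing `x'` with the lift `w` gives a section of `X ×_G A`, classified by a map to `Q`.
    obtain ⟨y, hy⟩ := IsComposite.exists_of_fst_eq (a := a) (f := f) (p := p)
      (z := (fibrePresheaf a p).map l.op w) (x := x')
      (congrArg (Points.mk (X := U) (T := T)) hl)
    obtain ⟨k, hk, hk'⟩ := hq T y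
    have hlk : l ≫ σ = k ≫ ρ := by
      rw [← hk] at hy
      exact congrArg (Points.map (X := A) (T := T)) hy.snd_eq
    refine ⟨pullback.lift l k hlk, ?_, fun m hm => ?_⟩
    · have := hx' (pullback.lift l k hlk)
      rw [pullback.lift_fst, pullback.lift_snd, hk] at this
      exact this.right_unique hy
    · have h := hx' m
      rw [hm] at h
      have hml : m ≫ pullback.fst σ ρ = l := by
        ext t
        apply hw.injective
        have := congrArg (Points.map (X := U) (T := T)) h.fst_eq
        exact congrArg (fun r : T ⟶ U => r t) (this.trans hl.symm)
      rw [hml] at h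
      apply pullback.hom_ext
      · rw [hml, pullback.lift_fst]
      · rw [pullback.lift_snd]
        exact hk' _ (h.middle_unique hy)

/-- Surjectivity puts `x` in the image of `U ×_G A → U`, so a local section exists near `x`; pulling
the universal section back along it gives `w`. -/
theorem Hom.IsAtlas.exists_local_section (hp : p.IsAtlas) (x : U) :
    ∃ (V : Set U) (W : TopCat.{u}) (w : (fibrePresheaf a p).obj (op W)), IsOpen V ∧ x ∈ V ∧
      Topology.IsEmbedding (fibreFst a p W w) ∧ Set.range (fibreFst a p W w) = V := by
  obtain ⟨B, e, he⟩ := hp.isRepresentable U a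
  let z : (fibrePresheaf a p).obj (op B) := (e.on ⟨op B⟩).obj (Points.mk (𝟙 B))
  have hz : Hom.toMap (e.vcomp (fibreProductFst a p)) = fibreFst a p B z := rfl
  have hs := hp.isSurjective U a B e he
  obtain ⟨N, hN, s, hs⟩ := hp.hasLocalSections U a B e he x (hs x)
  rw [hz] at hs
  -- The neighbourhood `N` need not be open, so the section is restricted to its interior.
  let k : TopCat.of (interior N) ⟶ B :=
    TopCat.ofHom (s.comp ⟨Set.inclusion interior_subset, continuous_inclusion _⟩)
  have hk : ⇑(fibreFst a p _ ((fibrePresheaf a p).map k.op z)) = Subtype.val := by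
    funext y
    exact hs _
  refine ⟨interior N, _, (fibrePresheaf a p).map k.op z, isOpen_interior,
    mem_interior_iff_mem_nhds.2 hN, ?_, ?_⟩
  · rw [hk]
    exact .subtypeVal
  · rw [hk]
    exact Subtype.range_coe

end LocalRepresentability

end GroupoidPresheaf

theorem mainTheorem12 (G : GroupoidPresheaf.{u, v, w}) (hG : G.IsTopologicalStack)
    (X : TopCat.{u}) (f : GroupoidPresheaf.Hom (GroupoidPresheaf.ofSpace.{u, v, w} X) G) :
    f.IsRepresentable := by
  intro U a
  obtain ⟨A, p, hp⟩ := hG.exists_atlas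
  obtain ⟨Q, q, hq⟩ := GroupoidPresheaf.exists_universalSection_of_isSpace
    (hp.isRepresentable X f)
  choose V W z hVo hVm hz hzV using fun x : U => hp.exists_local_section (a := a) x
  choose P y hy using fun x => GroupoidPresheaf.exists_universalAmong_liesOver (z x) (hz x)
    (hzV x) hq
  obtain ⟨y₀, hy₀⟩ := TopCat.exists_universal_glued (GroupoidPresheaf.fibreFst a f)
    GroupoidPresheaf.fibreFst_map hVo hVm hy
    (GroupoidPresheaf.fibrePresheaf_isOpenCoverSheaf hG.isStack)
  exact GroupoidPresheaf.isSpace_of_universalSection hy₀
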